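/- **Setting.** Let $X$ be a Hausdorff locally convex space over $\mathbb T\in\{\mathbb R,\mathbb C\}$ (its topology is generated by a family of semi-norms), and let $\mathcal L(X)$ be the set of continuous linear operators on $X$, with identity $I$. For $F:[0,\infty)\to\mathcal L(X)$, the many-valued effective derivative $F'_{mef}(0)$ assigns to $f\in X$ the set of all $g\in X$ for which there is a family $(f_s)_{s\ge 0}$ in $X$ with $f_s\to f$ and $s^{-1}(F(s)-F(0))f_s\to g$ as $s\to 0^+$; its domain is the linear subspace of all $f$ for which this set is non-empty. If every such set has exactly one element, $F'_{mef}(0)$ is called single-valued, and the resulting linear operator is the effective derivative $F'_{ef}(0)$. The class $\mathcal F_X$ consists of all $F:[0,\infty)\to\mathcal L(X)$ such that $F(0)=I$; for each $s\ge 0$ the family $\{F(d/n)^m : m,n\in\mathbb N,\ d\ge 0,\ md/n\le s\}$ (with $m,n\geq 1$) is equicontinuous; and the domain of $F'_{mef}(0)$ is dense in $X$. For a linear operator $A$ with domain $\mathcal D(A)\subset X$ and $l>0$, a local solution on $[0,l)$ of $f'=Af$, $f(0)=h$ is a function $f:[0,l)\to X$ with $f(0)=h$ such that, for every $t\in[0,l)$,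 $f(t)\in\mathcal D(A)$, and the derivative of $f$ at $t$ (the limit in $X$ of the difference quotients within $[0,l)$, so one-sided at $t=0$) exists and equals $Af(t)$. **Theorem.** Let $F\in\mathcal F_X$. Then $F'_{mef}(0)$ is single-valued, so $F'_{ef}(0)$ exists. Let $Z$ be a linear operator with domain $\mathcal D(Z)\subset\mathcal D(F'_{ef}(0))$ and $Zg=F'_{ef}(0)g$ for all $g\in\mathcal D(Z)$. Then $Z$ is closable. Let $\overline Z$ be its closure (the operator whose graph is the closure of the graph of $Z$ in $X\times X$). If $f:[0,l)\to X$ is a local solution of $$f'(t)=\overline Z f(t),\quad t\in[0,l),\qquad f(0)=h\in\mathcal D(\overline Z),$$ then for every $t_0\in(0,l)$, $$F\!\left(\tfrac tn\right)^{n}h\longrightarrow f(t)\quad\text{as } n\to\infty,\text{ uniformly in } t\in[0,t_0].$$ -/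

import Mathlib

open Set Filter Topology
open scoped NNReal

namespace Chernoff

variable {𝕜 X : Type*} [RCLike 𝕜] [AddCommGroup X] [Module 𝕜 X]

section Topological

variable [TopologicalSpace X]

/-- The many-valued effective derivative at `0` of `F : [0, ∞) → L(X)`: the value at `f` is the set
of all limits of `s⁻¹ (F(s) - F(0)) u_s` as `s → 0+`, over the families `u` with `u_s → f`. -/
def mefDeriv (F : ℝ≥0 → X →L[𝕜] X) (f : X) : Set X :=
  {g | ∃ u : ℝ≥0 → X, Tendsto u (𝓝[>] 0) (𝓝 f) ∧
    Tendsto (fun s : ℝ≥0 => ((s : ℝ) : 𝕜)⁻¹ • (F s (u s) - F 0 (u s))) (𝓝[>] 0) (𝓝 g)}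

/-- The domain of the many-valued effective derivative: where it has at least one value. -/
def mefDomain (F : ℝ≥0 → X →L[𝕜] X) : Set X :=
  {f | (mefDeriv F f).Nonempty}

/-- The many-valued effective derivative takes exactly one value at each point of its domain. -/
def MefSingleValued (F : ℝ≥0 → X →L[𝕜] X) : Prop :=
  ∀ f ∈ mefDomain F, ∃! g, g ∈ mefDeriv F f

variable [IsTopologicalAddGroup X] [ContinuousSMul 𝕜 X]

/-- The graph of the many-valued effective derivative, as a linear subspace of `X × X`. -/
def mefGraph (F : ℝ≥0 → X →L[𝕜] X) : Submodule 𝕜 (X × X) where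
  carrier := {p | p.2 ∈ mefDeriv F p.1}
  add_mem' := by
    rintro a b ⟨u, hu, hu'⟩ ⟨v, hv, hv'⟩
    refine ⟨fun s => u s + v s, hu.add hv, (hu'.add hv').congr fun s => ?_⟩
    simp only [map_add]
    rw [← smul_add]
    congr 1
    abel
  zero_mem' := ⟨fun _ => 0, tendsto_const_nhds, by simpa using tendsto_const_nhds⟩
  smul_mem' := by
    rintro c a ⟨u, hu, hu'⟩
    refine ⟨fun s => c • u s, hu.const_smul c, (hu'.const_smul c).congr fun s => ?_⟩
    rw [map_smul, map_smul, ← smul_sub, smul_comm]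

/-- The effective derivative `F'_ef(0)` as a linear operator on the domain of the many-valued
effective derivative: its graph is `mefGraph F` as soon as the latter is single-valued. -/
noncomputable def effDeriv (F : ℝ≥0 → X →L[𝕜] X) : X →ₗ.[𝕜] X :=
  (mefGraph F).toLinearPMap

/-- `f : [0, l) → X` is a local solution of `f' = A f`, `f(0) = h`: at each `t ∈ [0, l)` the value
`f t` lies in the domain of `A` and the difference quotients of `f`, taken within `[0, l)`, converge
to `A (f t)`. Only the values of `f` on `[0, l)` matter. -/
structure IsLocalSolution (A : X →ₗ.[𝕜] X) (l : ℝ) (h : X) (f : ℝ → X) : Prop where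
  pos : 0 < l
  init : f 0 = h
  deriv : ∀ t ∈ Ico 0 l, ∃ ht : f t ∈ A.domain,
    Tendsto (fun s : ℝ => ((s - t : ℝ) : 𝕜)⁻¹ • (f s - f t)) (𝓝[Ico 0 l \ {t}] t)
      (𝓝 (A ⟨f t, ht⟩))

end Topological

section Uniform

variable [UniformSpace X]

/-- The family of all powers `F(d/n)^m` with `m, n ≥ 1`, `d ≥ 0` and `m d / n ≤ s`. -/
def powerFamily (F : ℝ≥0 → X →L[𝕜] X) (s : ℝ≥0) : Set (X →L[𝕜] X) :=
  {G | ∃ (m n : ℕ) (d : ℝ≥0), 1 ≤ m ∧ 1 ≤ n ∧ (m : ℝ≥0) * d / n ≤ s ∧ G = F (d / n) ^ m}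

/-- `F(0) = I` and for every `s` the powers `F(d/n)^m`, `m d / n ≤ s`, are equicontinuous. -/
structure MemE (F : ℝ≥0 → X →L[𝕜] X) : Prop where
  map_zero : F 0 = ContinuousLinearMap.id 𝕜 X
  equicontinuous : ∀ s : ℝ≥0,
    Equicontinuous (fun G : powerFamily F s => ((G : X →L[𝕜] X) : X → X))

/-- The class of functions satisfying `MemE` whose many-valued effective derivative at `0` is
densely defined. -/
structure MemF (F : ℝ≥0 → X →L[𝕜] X) : Prop extends MemE F where
  dense_domain : Dense (mefDomain F)

end Uniform

end Chernoff

/-!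
Write `τ` for a step size and `m` for a number of steps. Instead of the sequence `F(t/n)^n`, all
powers `F(τ)^m` with `τ → 0` and `m τ → t` are considered at once (`stepFilter t`). A power along
`stepFilter b` factors into a power along `stepFilter a` and one along `stepFilter (b - a)`
(`eventually_stepFilter_add`), so the powers behave like an approximate semigroup, and convergence
along `stepFilter t` for every `t` is continuous convergence, hence uniform on compact sets.

The core estimate is `MemF.eventually_pow_sub_le`. If `(x, y)` is in the closure of the graph of the
many-valued effective derivative, then for small `s` and every continuous seminorm `p`,
`p (F(τ)^m x - x - s y) ≤ ε s + o(1)` along `stepFilter s`. It comes from telescoping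
`F(τ)^m u - u = ∑_{j < m} τ F(τ)^j v` where `F(τ) u = u + τ v`, with `u` near `x` and `v` near `y`,
together with `F(τ)^j y ≈ y` for small `j τ` (`MemF.tendsto_pow_stepFilter_zero`). That `s`-range
does not depend on the pair of the graph that approximates `(x, y)`, which is why the closure is
allowed. For `x = 0` the left side tends to `s p(y)`, which forces `y = 0`: this gives
single-valuedness and closability together (`MemF.eq_zero_of_mem_closure_mefGraph`).

For a local solution `f`, the derivative `f'` need not be continuous, so no integral is available.
Differentiability at `t` and the core estimate at `(f t, f' t)` give
`F(τ)^m f(t) ≈ f(b)` along `stepFilter (b - t)` with error `ε (b - t)` for `b` slightly larger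
than `t`. By equicontinuity these errors add up, and the bound `ε t` for the error of
`F(τ)^m f(0) ≈ f(t)` is propagated from `0` to any `t < l` by continuous induction
(`MemF.eventually_pow_sub_solution_le`).
-/

namespace Chernoff

variable {𝕜 X : Type*} [RCLike 𝕜] [AddCommGroup X] [Module 𝕜 X]

/-! ### Step sizes and iteration counts -/

/-- The filter on pairs `(τ, m)` of a step size and a number of steps that describes `τ → 0` and
`m τ → s`. The step size `0` is allowed. -/
def stepFilter (s : ℝ) : Filter (ℝ≥0 × ℕ) :=
  comap (fun z => (z.1, (z.2 : ℝ) * z.1)) (𝓝 0 ×ˢ 𝓝 s)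

theorem tendsto_fst_stepFilter (s : ℝ) : Tendsto Prod.fst (stepFilter s) (𝓝 0) :=
  (tendsto_fst (g := 𝓝 s)).comp tendsto_comap

theorem tendsto_mul_stepFilter (s : ℝ) :
    Tendsto (fun z : ℝ≥0 × ℕ => (z.2 : ℝ) * z.1) (stepFilter s) (𝓝 s) :=
  (tendsto_snd (f := 𝓝 (0 : ℝ≥0))).comp tendsto_comap

theorem eventually_stepFilter_iff {s : ℝ} {P : ℝ≥0 → ℕ → Prop} :
    (∀ᶠ z in stepFilter s, P z.1 z.2) ↔
      ∃ δ > 0, ∀ (τ : ℝ≥0) (m : ℕ), (τ : ℝ) < δ → |(m : ℝ) * τ - s| < δ → P τ m := by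
  have h : (stepFilter s).HasBasis (fun δ : ℝ => 0 < δ) _ :=
    ((Metric.nhds_basis_ball (x := (0 : ℝ≥0))).prod_same_index Metric.nhds_basis_ball
      (fun {i j} hi hj => ⟨min i j, lt_min hi hj, Metric.ball_subset_ball (min_le_left _ _),
        Metric.ball_subset_ball (min_le_right _ _)⟩)).comap _
  rw [h.eventually_iff]
  refine exists_congr fun δ => and_congr_right fun _ => ?_
  simp only [mem_preimage, mem_prod, Metric.mem_ball, Prod.forall, and_imp, NNReal.dist_eq,
    Real.dist_eq, NNReal.coe_zero, sub_zero, NNReal.abs_eq]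

/-- The choice `τ = t / n`, `m = n`, jointly in `n → ∞` and the time variable. -/
theorem tendsto_stepFilter (t : ℝ) :
    Tendsto (fun q : ℕ × ℝ => (q.2.toNNReal / (q.1 : ℝ≥0), q.1)) (atTop ×ˢ 𝓝[Ici 0] t)
      (stepFilter t) := by
  have hid : Tendsto (fun q : ℕ × ℝ => q.2) (atTop ×ˢ 𝓝[Ici 0] t) (𝓝 t) :=
    tendsto_snd.mono_right nhdsWithin_le_nhds
  refine tendsto_comap_iff.2 (Tendsto.prodMk ?_ ?_)
  · have h1 : Tendsto (fun q : ℕ × ℝ => q.2.toNNReal * ((q.1 : ℝ≥0))⁻¹) (atTop ×ˢ 𝓝[Ici 0] t)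
        (𝓝 (t.toNNReal * 0)) :=
      ((continuous_real_toNNReal.tendsto t).comp hid).mul
        ((tendsto_inv_atTop_nhds_zero_nat (𝕜 := ℝ≥0)).comp tendsto_fst)
    simpa [div_eq_mul_inv, Function.comp_def] using h1
  · refine hid.congr' ?_
    have hpos : ∀ᶠ q : ℕ × ℝ in atTop ×ˢ 𝓝[Ici 0] t, 0 < q.1 :=
      tendsto_fst.eventually (eventually_gt_atTop 0)
    have hnn : ∀ᶠ q : ℕ × ℝ in atTop ×ˢ 𝓝[Ici 0] t, 0 ≤ q.2 :=
      tendsto_snd.eventually eventually_mem_nhdsWithin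
    filter_upwards [hpos, hnn] with q hq hq'
    have : (q.1 : ℝ) ≠ 0 := by exact_mod_cast hq.ne'
    simp only [NNReal.coe_div, NNReal.coe_natCast, Real.coe_toNNReal _ hq']
    field_simp

theorem neBot_stepFilter {t : ℝ} (ht : 0 ≤ t) : (stepFilter t).NeBot :=
  have : (𝓝[Ici 0] t).NeBot := nhdsWithin_Ici_neBot ht
  (tendsto_stepFilter t).neBot

/-- A property that holds eventually as `τ → 0` and `m τ → 0` holds, for small total time `s`, at
every intermediate step of a run along `stepFilter s`. -/
theorem exists_eventually_stepFilter {P : ℝ≥0 → ℕ → Prop}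
    (h : ∀ᶠ z in stepFilter 0, P z.1 z.2) :
    ∃ δ > 0, ∀ s ∈ Ico 0 δ, ∀ᶠ z in stepFilter s, ∀ j ≤ z.2, P z.1 j := by
  obtain ⟨δ, hδ, H⟩ := eventually_stepFilter_iff.1 h
  refine ⟨δ, hδ, fun s hs => ?_⟩
  have h1 := (tendsto_fst_stepFilter s).eventually (gt_mem_nhds (Real.toNNReal_pos.2 hδ))
  have h2 := (tendsto_mul_stepFilter s).eventually (gt_mem_nhds hs.2)
  filter_upwards [h1, h2] with z hz1 hz2 j hj
  refine H _ _ (Real.lt_toNNReal_iff_coe_lt.1 hz1) ?_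
  rw [sub_zero, abs_of_nonneg (by positivity)]
  refine lt_of_le_of_lt ?_ hz2
  gcongr

/-- A run of total time about `b` splits into a run of total time about `a` followed by one of total
time about `b - a`, with the same step size. -/
theorem eventually_stepFilter_add {a b : ℝ} (ha : 0 ≤ a) (hab : a < b)
    {P Q : ℝ≥0 → ℕ → Prop} (hP : ∀ᶠ z in stepFilter a, P z.1 z.2)
    (hQ : ∀ᶠ z in stepFilter (b - a), Q z.1 z.2) :
    ∀ᶠ z in stepFilter b, ∃ i j, z.2 = i + j ∧ P z.1 i ∧ Q z.1 j := by
  obtain ⟨δ, hδ, H⟩ := eventually_stepFilter_iff.1 hP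
  obtain ⟨ε, hε, K⟩ := eventually_stepFilter_iff.1 hQ
  -- The first run takes `⌊a / τ⌋` steps. The bound `b - a` on `|m τ - b|` gives `a < m τ`, so that
  -- `τ ≠ 0` and the subtraction `m - ⌊a / τ⌋` is not truncated.
  refine (eventually_stepFilter_iff (P := fun τ m => ∃ i j, m = i + j ∧ P τ i ∧ Q τ j)).2
    ⟨min (min δ (ε / 2)) (b - a),
    lt_min (lt_min hδ (by positivity)) (sub_pos.2 hab), fun τ m hτ hm => ?_⟩
  obtain ⟨⟨hτ1, hτ2⟩, -⟩ := by simpa only [lt_min_iff] using hτ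
  obtain ⟨⟨hm1, hm2⟩, hm3⟩ := by simpa only [lt_min_iff] using hm
  rw [abs_lt] at hm1 hm2 hm3
  have hm4 : a < m * τ := by linarith
  have hτ0 : (0 : ℝ) < τ := by
    rcases eq_or_lt_of_le τ.coe_nonneg with h | h
    · rw [← h, mul_zero] at hm4
      linarith
    · exact h
  have hle : (⌊a / τ⌋₊ : ℝ) * τ ≤ a := (le_div_iff₀ hτ0).1 (Nat.floor_le (by positivity))
  have hlt : a < (⌊a / τ⌋₊ + 1 : ℝ) * τ := (div_lt_iff₀ hτ0).1 (Nat.lt_floor_add_one _)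
  have him : ⌊a / (τ : ℝ)⌋₊ ≤ m := by
    have : (⌊a / (τ : ℝ)⌋₊ : ℝ) * τ < m * τ := by linarith
    exact_mod_cast (lt_of_mul_lt_mul_right this hτ0.le).le
  refine ⟨⌊a / (τ : ℝ)⌋₊, m - ⌊a / (τ : ℝ)⌋₊, by omega, H _ _ hτ1 ?_, K _ _ (by linarith) ?_⟩
  · rw [abs_lt]
    constructor <;> linarith
  · rw [Nat.cast_sub him, abs_lt]
    constructor <;> linarith

/-! ### Seminorms, slopes and powers of a single operator -/

theorem seminorm_ofReal_smul (p : Seminorm 𝕜 X) {r : ℝ} (hr : 0 ≤ r) (x : X) :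
    p ((r : 𝕜) • x) = r * p x := by
  rw [map_smul_eq_mul, RCLike.norm_of_nonneg hr]

section Topological

variable [TopologicalSpace X]

/-- A value `g` of the many-valued effective derivative at `f` is given by families `u → f` and
`v → g` with `F(τ) u_τ = u_τ + τ v_τ`. Setting `u_0 = f` and `v_0 = g` makes the families converge
along the full neighbourhood filter of `0`, so that the step size `0` needs no separate treatment. -/
theorem exists_increment_of_mem_mefDeriv {F : ℝ≥0 → X →L[𝕜] X}
    (hF : F 0 = ContinuousLinearMap.id 𝕜 X) {f g : X} (h : g ∈ mefDeriv F f) :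
    ∃ u v : ℝ≥0 → X, Tendsto u (𝓝 0) (𝓝 f) ∧ Tendsto v (𝓝 0) (𝓝 g) ∧
      ∀ τ, F τ (u τ) = u τ + ((τ : ℝ) : 𝕜) • v τ := by
  classical
  obtain ⟨u, hu, hv⟩ := h
  refine ⟨Function.update u 0 f, Function.update
    (fun s : ℝ≥0 => ((s : ℝ) : 𝕜)⁻¹ • (F s (u s) - F 0 (u s))) 0 g, ?_, ?_, fun τ => ?_⟩
  · simpa [ContinuousAt] using
      (continuousAt_update_same (f := u) (x := 0) (y := f)).2
        (hu.mono_left (nhdsWithin_mono _ fun s hs => pos_iff_ne_zero.2 hs))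
  · simpa [ContinuousAt] using
      (continuousAt_update_same
        (f := fun s : ℝ≥0 => ((s : ℝ) : 𝕜)⁻¹ • (F s (u s) - F 0 (u s))) (x := 0) (y := g)).2
        (hv.mono_left (nhdsWithin_mono _ fun s hs => pos_iff_ne_zero.2 hs))
  · rcases eq_or_ne τ 0 with rfl | hτ
    · simp [hF]
    · have : ((τ : ℝ) : 𝕜) ≠ 0 := by simpa using hτ
      simp [hτ, hF, smul_smul]

/-- Telescoping: if `A u = u + τ v`, then `A^m u - u` is the sum of the `τ A^j v` over `j < m`, hence
close to `m τ y` when all `A^j v` are close to `y`. -/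
theorem seminorm_pow_sub_le (p : Seminorm 𝕜 X) {A : X →L[𝕜] X} {τ c : ℝ} (hτ : 0 ≤ τ) {u v y : X}
    (hA : A u = u + (τ : 𝕜) • v) (m : ℕ) (hc : ∀ j < m, p ((A ^ j) v - y) ≤ c) :
    p ((A ^ m) u - u - ((m * τ : ℝ) : 𝕜) • y) ≤ m * τ * c := by
  induction m with
  | zero => simp
  | succ m ih =>
    have key : (A ^ (m + 1)) u - u - (((m + 1 : ℕ) * τ : ℝ) : 𝕜) • y =
        ((A ^ m) u - u - ((m * τ : ℝ) : 𝕜) • y) + (τ : 𝕜) • ((A ^ m) v - y) := by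
      rw [pow_succ, mul_apply_eq_comp, hA, map_add, map_smul]
      push_cast
      module
    rw [key]
    refine (map_add_le_add p _ _).trans ?_
    rw [seminorm_ofReal_smul p hτ]
    have h1 := ih fun j hj => hc j (hj.trans m.lt_succ_self)
    have h2 := mul_le_mul_of_nonneg_left (hc m m.lt_succ_self) hτ
    have h3 : ((m + 1 : ℕ) : ℝ) * τ * c = m * τ * c + τ * c := by
      push_cast
      ring
    linarith

theorem tendsto_iff_forall_seminorm [PolynormableSpace 𝕜 X] {α : Type*} {L : Filter α}
    {u : α → X} {x : X} :
    Tendsto u L (𝓝 x) ↔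
      ∀ p : Seminorm 𝕜 X, Continuous p → ∀ ε > 0, ∀ᶠ a in L, p (u a - x) < ε := by
  rw [(PolynormableSpace.withSeminorms 𝕜 X).tendsto_nhds]
  simp [Subtype.forall]

theorem continuousWithinAt_of_tendsto_slope [ContinuousAdd X] [ContinuousSMul 𝕜 X]
    {s : Set ℝ} {f : ℝ → X} {t : ℝ} {y : X}
    (h : Tendsto (fun r : ℝ => ((r - t : ℝ) : 𝕜)⁻¹ • (f r - f t)) (𝓝[s \ {t}] t) (𝓝 y)) :
    ContinuousWithinAt f s t := by
  rw [← continuousWithinAt_sdiff_self]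
  have h1 : Tendsto (fun r : ℝ => ((r - t : ℝ) : 𝕜)) (𝓝[s \ {t}] t) (𝓝 0) := by
    have : Continuous fun r : ℝ => ((r - t : ℝ) : 𝕜) := by fun_prop
    simpa using (this.tendsto t).mono_left nhdsWithin_le_nhds
  have h2 := (h1.smul h).add_const (f t)
  rw [zero_smul, zero_add] at h2
  refine h2.congr' ?_
  filter_upwards [self_mem_nhdsWithin] with r hr
  have : ((r - t : ℝ) : 𝕜) ≠ 0 := by
    rw [RCLike.ofReal_ne_zero]
    exact sub_ne_zero.2 hr.2
  rw [smul_inv_smul₀ this, sub_add_cancel]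

/-- Concatenation of approximations. The first one is measured after `k` further steps within the
time horizon `S`, because powers of `F τ` do not contract a fixed seminorm; in this form the errors
of successive time intervals add up with no loss of constants. -/
theorem eventually_pow_concat {F : ℝ≥0 → X →L[𝕜] X} {p q : Seminorm 𝕜 X} {S a b α β : ℝ}
    (H : ∀ (τ : ℝ≥0) (m : ℕ) (x : X), (m : ℝ) * τ ≤ S → p ((F τ ^ m) x) ≤ q x)
    {h x w : X} (ha : 0 ≤ a) (hab : a < b)
    (h₁ : ∀ᶠ z in stepFilter a, ∀ k : ℕ, ((k + z.2 : ℕ) : ℝ) * z.1 ≤ S →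
      p ((F z.1 ^ k) ((F z.1 ^ z.2) h - x)) ≤ α)
    (h₂ : ∀ᶠ z in stepFilter (b - a), q ((F z.1 ^ z.2) x - w) ≤ β) :
    ∀ᶠ z in stepFilter b, ∀ k : ℕ, ((k + z.2 : ℕ) : ℝ) * z.1 ≤ S →
      p ((F z.1 ^ k) ((F z.1 ^ z.2) h - w)) ≤ α + β := by
  filter_upwards [eventually_stepFilter_add ha hab
    (P := fun τ i => ∀ k : ℕ, ((k + i : ℕ) : ℝ) * τ ≤ S → p ((F τ ^ k) ((F τ ^ i) h - x)) ≤ α)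
    (Q := fun τ j => q ((F τ ^ j) x - w) ≤ β) h₁ h₂]
  rintro ⟨τ, m⟩ ⟨i, j, rfl : m = i + j, hi, hj⟩ k hk
  have hsplit : (F τ ^ k) ((F τ ^ (i + j)) h - w) =
      (F τ ^ (k + j)) ((F τ ^ i) h - x) + (F τ ^ k) ((F τ ^ j) x - w) := by
    rw [add_comm i j, pow_add, pow_add]
    simp only [mul_apply_eq_comp, map_sub]
    abel
  simp only at hk ⊢
  rw [hsplit]
  refine (map_add_le_add p _ _).trans (add_le_add (hi _ ?_) ((H _ _ _ ?_).trans hj))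
  · rwa [add_assoc, add_comm j i]
  · refine le_trans ?_ hk
    gcongr
    omega

end Topological

section Polynormable

variable [UniformSpace X] [IsUniformAddGroup X] [ContinuousSMul 𝕜 X] [PolynormableSpace 𝕜 X]

/-- Equicontinuity in terms of seminorms, including the power `m = 0`. -/
theorem MemE.exists_seminorm_bound {F : ℝ≥0 → X →L[𝕜] X} (hF : MemE F) (S : ℝ≥0)
    (p : Seminorm 𝕜 X) (hp : Continuous p) :
    ∃ q : Seminorm 𝕜 X, Continuous q ∧ (∀ x, p x ≤ q x) ∧
      ∀ (τ : ℝ≥0) (m : ℕ) (x : X), (m : ℝ) * τ ≤ S → p ((F τ ^ m) x) ≤ q x := by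
  have h := ((PolynormableSpace.withSeminorms 𝕜 X).equicontinuous_TFAE
    (fun G : powerFamily F S => ((G : X →L[𝕜] X) : X →ₗ[𝕜] X))).out 1 3
  obtain ⟨q, hq, H⟩ := h.1 (hF.equicontinuous S) ⟨p, hp⟩
  refine ⟨p + q, hp.add hq, fun x => le_add_of_nonneg_right (apply_nonneg q x), fun τ m x hm => ?_⟩
  rcases Nat.eq_zero_or_pos m with rfl | hm0
  · exact le_add_of_nonneg_right (apply_nonneg q x)
  · have hmem : F τ ^ m ∈ powerFamily F S :=
      ⟨m, 1, τ, hm0, le_rfl, by simpa using (by exact_mod_cast hm : (m : ℝ≥0) * τ ≤ S), by simp⟩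
    exact (H ⟨_, hmem⟩ x).trans (le_add_of_nonneg_left (apply_nonneg p x))

/-! ### Strong continuity and the first-order expansion -/

/-- Strong continuity at time `0`. On the domain of the effective derivative
`F(τ)^m u_τ - u_τ` is `O(m τ)`; density and equicontinuity extend this to all of `X`. -/
theorem MemF.tendsto_pow_stepFilter_zero {F : ℝ≥0 → X →L[𝕜] X} (hF : MemF F) (x : X) :
    Tendsto (fun z : ℝ≥0 × ℕ => (F z.1 ^ z.2) x) (stepFilter 0) (𝓝 x) := by
  rw [tendsto_iff_forall_seminorm (𝕜 := 𝕜)]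
  intro p hp ε hε
  obtain ⟨q, hq, hpq, H⟩ := hF.exists_seminorm_bound 1 p hp
  obtain ⟨g, ⟨w, hw⟩, hg⟩ : ∃ g ∈ mefDomain F, q (x - g) < ε / 4 := by
    have hopen : IsOpen {g | q (x - g) < ε / 4} :=
      isOpen_lt (hq.comp (continuous_const.sub continuous_id)) continuous_const
    obtain ⟨g, hg, hg'⟩ := hF.dense_domain.exists_mem_open hopen
      ⟨x, by simpa using (by positivity : 0 < ε / 4)⟩
    exact ⟨g, hg, hg'⟩
  obtain ⟨u, v, hu, hv, huv⟩ := exists_increment_of_mem_mefDeriv hF.map_zero hw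
  have hfst := tendsto_fst_stepFilter 0
  have hmul := tendsto_mul_stepFilter 0
  have e1 : ∀ᶠ z in stepFilter 0, q (x - u z.1) < ε / 4 :=
    (((hq.comp (continuous_const.sub continuous_id)).tendsto g).comp
      (hu.comp hfst)).eventually_lt_const hg
  have e2 : ∀ᶠ z in stepFilter 0, (z.2 : ℝ) * z.1 * q (v z.1) < ε / 2 := by
    have : Tendsto (fun z : ℝ≥0 × ℕ => (z.2 : ℝ) * z.1 * q (v z.1)) (stepFilter 0)
        (𝓝 (0 * q w)) := hmul.mul ((hq.tendsto w).comp (hv.comp hfst))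
    exact this.eventually_lt_const (by rw [zero_mul]; positivity)
  have e3 : ∀ᶠ z in stepFilter 0, (z.2 : ℝ) * z.1 < 1 := hmul.eventually_lt_const one_pos
  filter_upwards [e1, e2, e3] with z h1 h2 h3
  have hb := seminorm_pow_sub_le p (y := 0) (c := q (v z.1)) z.1.coe_nonneg (huv z.1) z.2
    (fun j hj => by
      rw [sub_zero]
      refine H _ _ _ (le_trans ?_ h3.le)
      gcongr)
  rw [smul_zero, sub_zero] at hb
  have hd : (F z.1 ^ z.2) x - x = (F z.1 ^ z.2) (x - u z.1) +
      (((F z.1 ^ z.2) (u z.1) - u z.1) - (x - u z.1)) := by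
    rw [map_sub]
    abel
  have i1 := map_add_le_add p ((F z.1 ^ z.2) (x - u z.1))
    (((F z.1 ^ z.2) (u z.1) - u z.1) - (x - u z.1))
  have i2 := map_sub_le_add p ((F z.1 ^ z.2) (u z.1) - u z.1) (x - u z.1)
  have i3 := H z.1 z.2 (x - u z.1) h3.le
  have i4 := hpq (x - u z.1)
  rw [hd]
  linarith

/-- First-order expansion `F(τ)^m x ≈ x + s y` at the points of the closure of the graph of the
many-valued effective derivative. The range of `s` depends on `y` and `ε` only, not on `η`. -/
theorem MemF.eventually_pow_sub_le {F : ℝ≥0 → X →L[𝕜] X} (hF : MemF F) {x y : X}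
    (hxy : (x, y) ∈ closure (mefGraph F : Set (X × X))) (p : Seminorm 𝕜 X) (hp : Continuous p)
    {ε : ℝ} (hε : 0 < ε) :
    ∃ δ > 0, ∀ s ∈ Ico 0 δ, ∀ η > 0, ∀ᶠ z in stepFilter s,
      p ((F z.1 ^ z.2) x - x - ((s : ℝ) : 𝕜) • y) ≤ ε * s + η := by
  obtain ⟨q, hq, hpq, H⟩ := hF.exists_seminorm_bound 1 p hp
  obtain ⟨δ, hδ, hy⟩ := exists_eventually_stepFilter (P := fun τ j => p ((F τ ^ j) y - y) < ε)
    ((tendsto_iff_forall_seminorm (𝕜 := 𝕜)).1 (hF.tendsto_pow_stepFilter_zero y) p hp ε hε)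
  refine ⟨min δ 1, lt_min hδ one_pos, fun s hs η hη => ?_⟩
  have hs1 : s < 1 := hs.2.trans_le (min_le_right _ _)
  have hcx : Continuous fun g : X => q (x - g) := hq.comp (continuous_const.sub continuous_id)
  have hcy : Continuous fun g : X => q (g - y) := hq.comp (continuous_id.sub continuous_const)
  -- The approximating pair may depend on `s` and `η`: it enters the final bound only through `η`.
  obtain ⟨⟨g, w⟩, ⟨hg, hw⟩, hgw⟩ : ∃ a : X × X, (q (x - a.1) < η / 5 ∧ q (a.2 - y) < η / 5) ∧
      a ∈ (mefGraph F : Set (X × X)) := by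
    refine mem_closure_iff.1 hxy {a | q (x - a.1) < η / 5 ∧ q (a.2 - y) < η / 5} ?_ ?_
    · exact (isOpen_lt (hcx.comp continuous_fst) continuous_const).inter
        (isOpen_lt (hcy.comp continuous_snd) continuous_const)
    · simpa using hη
  obtain ⟨u, v, hu, hv, huv⟩ := exists_increment_of_mem_mefDeriv hF.map_zero hgw
  have hfst := tendsto_fst_stepFilter s
  have hmul := tendsto_mul_stepFilter s
  have e1 : ∀ᶠ z in stepFilter s, q (x - u z.1) < η / 5 :=
    ((hcx.tendsto g).comp (hu.comp hfst)).eventually_lt_const hg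
  have e2 : ∀ᶠ z in stepFilter s, q (v z.1 - y) < η / 5 :=
    ((hcy.tendsto w).comp (hv.comp hfst)).eventually_lt_const hw
  have e3 : ∀ᶠ z in stepFilter s, (z.2 : ℝ) * z.1 < 1 := hmul.eventually_lt_const hs1
  have e4 : ∀ᶠ z in stepFilter s, |(z.2 : ℝ) * z.1 - s| * p y < η / 5 := by
    have : Tendsto (fun z : ℝ≥0 × ℕ => |(z.2 : ℝ) * z.1 - s| * p y) (stepFilter s)
        (𝓝 (|s - s| * p y)) := ((hmul.sub_const s).abs).mul_const _
    exact this.eventually_lt_const (by simpa using hη)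
  have e5 : ∀ᶠ z in stepFilter s, ε * ((z.2 : ℝ) * z.1) < ε * s + η / 5 :=
    (hmul.const_mul ε).eventually_lt_const (by linarith)
  filter_upwards [e1, e2, e3, e4, e5, hy s ⟨hs.1, hs.2.trans_le (min_le_left _ _)⟩]
    with z h1 h2 h3 h4 h5 h6
  have hb := seminorm_pow_sub_le p (y := y) (c := ε + η / 5) z.1.coe_nonneg (huv z.1) z.2
    (fun j hj => by
      have hle : (j : ℝ) * z.1 ≤ (1 : ℝ≥0) := le_trans (by gcongr) h3.le
      have : (F z.1 ^ j) (v z.1) - y = (F z.1 ^ j) (v z.1 - y) + ((F z.1 ^ j) y - y) := by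
        rw [map_sub]
        abel
      rw [this]
      have := map_add_le_add p ((F z.1 ^ j) (v z.1 - y)) ((F z.1 ^ j) y - y)
      have := H z.1 j (v z.1 - y) hle
      have := h6 j hj.le
      linarith)
  have hd : (F z.1 ^ z.2) x - x - ((s : ℝ) : 𝕜) • y =
      ((F z.1 ^ z.2) (x - u z.1) - (x - u z.1)) +
      (((F z.1 ^ z.2) (u z.1) - u z.1 - (((z.2 : ℝ) * z.1 : ℝ) : 𝕜) • y) +
        (((z.2 : ℝ) * z.1 - s : ℝ) : 𝕜) • y) := by
    rw [map_sub, RCLike.ofReal_sub]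
    module
  have i1 := map_add_le_add p ((F z.1 ^ z.2) (x - u z.1) - (x - u z.1))
      (((F z.1 ^ z.2) (u z.1) - u z.1 - (((z.2 : ℝ) * z.1 : ℝ) : 𝕜) • y) +
        (((z.2 : ℝ) * z.1 - s : ℝ) : 𝕜) • y)
  have i2 := map_add_le_add p ((F z.1 ^ z.2) (u z.1) - u z.1 - (((z.2 : ℝ) * z.1 : ℝ) : 𝕜) • y)
    ((((z.2 : ℝ) * z.1 - s : ℝ) : 𝕜) • y)
  have i3 := map_sub_le_add p ((F z.1 ^ z.2) (x - u z.1)) (x - u z.1)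
  have i4 := H z.1 z.2 (x - u z.1) h3.le
  have i5 := hpq (x - u z.1)
  have i6 : p ((((z.2 : ℝ) * z.1 - s : ℝ) : 𝕜) • y) = |(z.2 : ℝ) * z.1 - s| * p y := by
    rw [map_smul_eq_mul, RCLike.norm_ofReal]
  have i7 : (z.2 : ℝ) * z.1 * (η / 5) ≤ η / 5 := mul_le_of_le_one_left (by positivity) h3.le
  rw [hd]
  linarith

/-- The closure of the graph of the many-valued effective derivative is single-valued. -/
theorem MemF.eq_zero_of_mem_closure_mefGraph [T2Space X] {F : ℝ≥0 → X →L[𝕜] X} (hF : MemF F)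
    {y : X} (hy : ((0 : X), y) ∈ closure (mefGraph F : Set (X × X))) : y = 0 := by
  have hz : ∀ p : Seminorm 𝕜 X, Continuous p → p y = 0 := by
    intro p hp
    refine le_antisymm (le_of_forall_pos_le_add fun ε hε => ?_) (apply_nonneg p y)
    obtain ⟨δ, hδ, H⟩ := hF.eventually_pow_sub_le hy p hp hε
    have hle : δ / 2 * p y ≤ ε * (δ / 2) := le_of_forall_pos_le_add fun η hη => by
      have := neBot_stepFilter (t := δ / 2) (by positivity)
      obtain ⟨z, hz⟩ := (H (δ / 2) ⟨by positivity, by linarith⟩ η hη).exists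
      rwa [map_zero, sub_zero, zero_sub, map_neg_eq_map,
        seminorm_ofReal_smul p (by positivity)] at hz
    rw [zero_add]
    exact le_of_mul_le_mul_left (by linarith) (by positivity : 0 < δ / 2)
  -- The constant `0` converges to `y` for the topology of the seminorms, which is Hausdorff.
  refine tendsto_nhds_unique (f := fun _ : Unit => (0 : X)) (l := pure ())
    ((tendsto_iff_forall_seminorm (𝕜 := 𝕜)).2 fun p hp ε hε => ?_) tendsto_const_nhds
  simpa [hz p hp] using hε

/-! ### Convergence along a local solution -/

/-- One step of the propagation to the right: from `f t`, the powers follow `f` up to an error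
proportional to the elapsed time. -/
theorem MemF.eventually_pow_sub_right_le {F : ℝ≥0 → X →L[𝕜] X} (hF : MemF F) {l : ℝ} {f : ℝ → X}
    {t : ℝ} (ht : 0 ≤ t) {y : X}
    (hd : Tendsto (fun r : ℝ => ((r - t : ℝ) : 𝕜)⁻¹ • (f r - f t)) (𝓝[Ico 0 l \ {t}] t) (𝓝 y))
    (hy : (f t, y) ∈ closure (mefGraph F : Set (X × X))) (p : Seminorm 𝕜 X) (hp : Continuous p)
    {ε : ℝ} (hε : 0 < ε) :
    ∃ δ > 0, ∀ b ∈ Ioo t l, b < t + δ → ∀ η > 0, ∀ᶠ z in stepFilter (b - t),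
      p ((F z.1 ^ z.2) (f t) - f b) ≤ ε * (b - t) + η := by
  obtain ⟨δ₁, hδ₁, H⟩ := hF.eventually_pow_sub_le hy p hp (half_pos hε)
  obtain ⟨δ₂, hδ₂, K⟩ := Metric.mem_nhdsWithin_iff.1
    ((tendsto_iff_forall_seminorm (𝕜 := 𝕜)).1 hd p hp _ (half_pos hε))
  refine ⟨min δ₁ δ₂, lt_min hδ₁ hδ₂, fun b hb hbδ η hη => ?_⟩
  have hb0 : 0 < b - t := sub_pos.2 hb.1
  have hb1 : b - t < δ₁ := by linarith [min_le_left δ₁ δ₂]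
  have hb2 : b - t < δ₂ := by linarith [min_le_right δ₁ δ₂]
  have hK : p (((b - t : ℝ) : 𝕜)⁻¹ • (f b - f t) - y) < ε / 2 :=
    K ⟨by rwa [Metric.mem_ball, Real.dist_eq, abs_of_pos hb0], ⟨ht.trans hb.1.le, hb.2⟩, hb.1.ne'⟩
  have hne : ((b - t : ℝ) : 𝕜) ≠ 0 := RCLike.ofReal_ne_zero.2 hb0.ne'
  have hfb : p (f b - f t - ((b - t : ℝ) : 𝕜) • y) ≤ ε / 2 * (b - t) := by
    have : f b - f t - ((b - t : ℝ) : 𝕜) • y =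
        ((b - t : ℝ) : 𝕜) • (((b - t : ℝ) : 𝕜)⁻¹ • (f b - f t) - y) := by
      rw [smul_sub, smul_inv_smul₀ hne]
    rw [this, seminorm_ofReal_smul p hb0.le, mul_comm]
    gcongr
  filter_upwards [H (b - t) ⟨hb0.le, hb1⟩ η hη] with z hz
  have hsplit : (F z.1 ^ z.2) (f t) - f b =
      ((F z.1 ^ z.2) (f t) - f t - ((b - t : ℝ) : 𝕜) • y) -
        (f b - f t - ((b - t : ℝ) : 𝕜) • y) := by abel
  rw [hsplit]
  refine (map_sub_le_add p _ _).trans ?_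
  linarith

/-- The powers started at `f t` stay close to `f T` for `t` slightly smaller than `T`. The error is
small but not proportional to `T - t`, which suffices for a passage to the limit `t → T`. -/
theorem MemF.eventually_pow_sub_left_le {F : ℝ≥0 → X →L[𝕜] X} (hF : MemF F) {l : ℝ} {f : ℝ → X}
    {T : ℝ} (hT : T < l) (hf : ContinuousWithinAt f (Ico 0 l) T)
    (p : Seminorm 𝕜 X) (hp : Continuous p) {η : ℝ} (hη : 0 < η) :
    ∃ δ > 0, ∀ t ∈ Ico 0 T, T < t + δ → ∀ᶠ z in stepFilter (T - t),
      p ((F z.1 ^ z.2) (f t) - f T) ≤ η := by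
  obtain ⟨q, hq, -, H⟩ := hF.exists_seminorm_bound 1 p hp
  obtain ⟨δ₁, hδ₁, K⟩ := exists_eventually_stepFilter
    (P := fun τ j => p ((F τ ^ j) (f T) - f T) < η / 2)
    ((tendsto_iff_forall_seminorm (𝕜 := 𝕜)).1 (hF.tendsto_pow_stepFilter_zero (f T)) p hp _
      (half_pos hη))
  obtain ⟨δ₂, hδ₂, G⟩ := Metric.mem_nhdsWithin_iff.1
    ((tendsto_iff_forall_seminorm (𝕜 := 𝕜)).1 hf q hq _ (half_pos hη))
  refine ⟨min (min δ₁ δ₂) 1, lt_min (lt_min hδ₁ hδ₂) one_pos, fun t ht htT => ?_⟩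
  have h0 : 0 < T - t := sub_pos.2 ht.2
  obtain ⟨⟨h1, h2⟩, h3⟩ : ((T - t < δ₁ ∧ T - t < δ₂) ∧ T - t < 1) := by
    simpa only [lt_min_iff] using (by linarith : T - t < min (min δ₁ δ₂) 1)
  have hG : q (f t - f T) < η / 2 := G ⟨by
    rwa [Metric.mem_ball, Real.dist_eq, abs_sub_comm, abs_of_pos h0], ht.1, ht.2.trans hT⟩
  filter_upwards [K (T - t) ⟨h0.le, h1⟩, (tendsto_mul_stepFilter _).eventually_lt_const h3]
    with z hz hz'
  have hsplit : (F z.1 ^ z.2) (f t) - f T =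
      (F z.1 ^ z.2) (f t - f T) + ((F z.1 ^ z.2) (f T) - f T) := by
    rw [map_sub]
    abel
  rw [hsplit]
  refine (map_add_le_add p _ _).trans ?_
  have := hz _ le_rfl
  have := H z.1 z.2 (f t - f T) hz'.le
  linarith

/-- The error of the powers along a solution grows at most like `ε T`. -/
theorem MemF.eventually_pow_sub_solution_le {F : ℝ≥0 → X →L[𝕜] X} (hF : MemF F) {l : ℝ}
    {f y : ℝ → X}
    (hd : ∀ t ∈ Ico 0 l, Tendsto (fun r : ℝ => ((r - t : ℝ) : 𝕜)⁻¹ • (f r - f t))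
      (𝓝[Ico 0 l \ {t}] t) (𝓝 (y t)))
    (hy : ∀ t ∈ Ico 0 l, (f t, y t) ∈ closure (mefGraph F : Set (X × X)))
    (p : Seminorm 𝕜 X) (hp : Continuous p) {ε : ℝ} (hε : 0 < ε) {T : ℝ} (hT : T ∈ Ico 0 l) :
    ∀ η > 0, ∀ᶠ z in stepFilter T, ∀ k : ℕ, ((k + z.2 : ℕ) : ℝ) * z.1 ≤ l →
      p ((F z.1 ^ k) ((F z.1 ^ z.2) (f 0) - f T)) ≤ ε * T + η := by
  have hl : 0 ≤ l := hT.1.trans hT.2.le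
  obtain ⟨q, hq, -, H⟩ := hF.exists_seminorm_bound l.toNNReal p hp
  rw [Real.coe_toNNReal _ hl] at H
  let P : ℝ → Prop := fun t => ∀ η > 0, ∀ᶠ z in stepFilter t, ∀ k : ℕ,
    ((k + z.2 : ℕ) : ℝ) * z.1 ≤ l → p ((F z.1 ^ k) ((F z.1 ^ z.2) (f 0) - f t)) ≤ ε * t + η
  have h0 : P 0 := by
    intro η hη
    filter_upwards [(tendsto_iff_forall_seminorm (𝕜 := 𝕜)).1
      (hF.tendsto_pow_stepFilter_zero (f 0)) q hq η hη] with z hz k hk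
    rw [mul_zero, zero_add]
    refine (H _ _ _ (le_trans ?_ hk)).trans hz.le
    gcongr
    omega
  have hright : ∀ t ∈ Ico 0 l, P t → ∃ δ > 0, ∀ b ∈ Ioo t l, b < t + δ → P b := by
    intro t ht hPt
    obtain ⟨δ, hδ, K⟩ := hF.eventually_pow_sub_right_le ht.1 (hd t ht) (hy t ht) q hq hε
    refine ⟨δ, hδ, fun b hb hbδ η hη => ?_⟩
    filter_upwards [eventually_pow_concat H ht.1 hb.1 (hPt _ (half_pos hη))
      (K b hb hbδ _ (half_pos hη))] with z hz k hk
    exact (hz k hk).trans_eq (by ring)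
  have hleft : ∀ t ∈ Ioo 0 l, (∀ s ∈ Ico 0 t, P s) → P t := by
    intro t ht hP η hη
    obtain ⟨δ, hδ, K⟩ := hF.eventually_pow_sub_left_le ht.2
      (continuousWithinAt_of_tendsto_slope (hd t ⟨ht.1.le, ht.2⟩)) q hq (half_pos hη)
    obtain ⟨s, hs1, hs2⟩ := exists_between (max_lt ht.1 (sub_lt_self t hδ))
    obtain ⟨hs0, hsδ⟩ := max_lt_iff.1 hs1
    filter_upwards [eventually_pow_concat H hs0.le hs2 (hP s ⟨hs0.le, hs2⟩ _ (half_pos hη))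
      (K s ⟨hs0.le, hs2⟩ (by linarith))] with z hz k hk
    have := hz k hk
    have : ε * s ≤ ε * t := by gcongr
    linarith
  -- Asking for `P` on all of `[0, t]` makes the set closed using limits from the left only.
  let A : Set ℝ := {t | ∀ s ∈ Icc 0 t, P s}
  have hA : Icc 0 T ⊆ A := by
    refine IsClosed.Icc_subset_of_forall_exists_gt ?_ ?_ ?_
    · refine isClosed_of_closure_subset fun t ht => ?_
      have htI : t ∈ Icc 0 T := closure_minimal inter_subset_right isClosed_Icc ht
      have hlt : ∀ s ∈ Ico 0 t, P s := by
        intro s hs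
        obtain ⟨r, hr, hr'⟩ := mem_closure_iff.1 ht (Ioi s) isOpen_Ioi hs.2
        exact hr'.1 s ⟨hs.1, (mem_Ioi.1 hr).le⟩
      refine ⟨fun s hs => ?_, htI⟩
      rcases hs.2.lt_or_eq with h | rfl
      · exact hlt s ⟨hs.1, h⟩
      · rcases hs.1.eq_or_lt with h | h
        · rwa [← h]
        · exact hleft s ⟨h, htI.2.trans_lt hT.2⟩ hlt
    · rintro s ⟨hs, hs'⟩
      rwa [le_antisymm hs' hs]
    · rintro t ⟨htA, ht0, htT⟩ b hb
      obtain ⟨δ, hδ, K⟩ := hright t ⟨ht0, htT.trans hT.2⟩ (htA t ⟨ht0, le_rfl⟩)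
      obtain ⟨r, hr1, hr2⟩ := exists_between (lt_min (lt_min hb htT) (lt_add_of_pos_right t hδ))
      obtain ⟨⟨hrb, hrT⟩, hrδ⟩ := by simpa only [lt_min_iff] using hr2
      refine ⟨r, fun s hs => ?_, hr1, hrb.le⟩
      rcases le_or_gt s t with h | h
      · exact htA s ⟨hs.1, h⟩
      · exact K s ⟨h, hs.2.trans_lt (hrT.trans hT.2)⟩ (hs.2.trans_lt hrδ)
  exact hA ⟨hT.1, le_rfl⟩ T ⟨hT.1, le_rfl⟩

theorem MemF.tendsto_pow_solution {F : ℝ≥0 → X →L[𝕜] X} (hF : MemF F) {l : ℝ} {f y : ℝ → X}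
    (hd : ∀ t ∈ Ico 0 l, Tendsto (fun r : ℝ => ((r - t : ℝ) : 𝕜)⁻¹ • (f r - f t))
      (𝓝[Ico 0 l \ {t}] t) (𝓝 (y t)))
    (hy : ∀ t ∈ Ico 0 l, (f t, y t) ∈ closure (mefGraph F : Set (X × X)))
    {T : ℝ} (hT : T ∈ Ico 0 l) :
    Tendsto (fun z : ℝ≥0 × ℕ => (F z.1 ^ z.2) (f 0)) (stepFilter T) (𝓝 (f T)) := by
  refine (tendsto_iff_forall_seminorm (𝕜 := 𝕜)).2 fun p hp ε hε => ?_
  have hc : 0 < ε / (2 * (T + 1)) := div_pos hε (by linarith [hT.1])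
  filter_upwards [hF.eventually_pow_sub_solution_le hd hy p hp hc hT (ε / 2) (half_pos hε),
    (tendsto_mul_stepFilter T).eventually_lt_const hT.2] with z hz hz'
  have h1 := hz 0 (by simpa using hz'.le)
  have h2 : ε / (2 * (T + 1)) * T < ε / 2 := by
    have := hT.1
    rw [div_mul_eq_mul_div, div_lt_div_iff₀ (by positivity) two_pos]
    nlinarith
  rw [pow_zero, one_apply_eq_self] at h1
  linarith

theorem MemF.tendstoUniformlyOn_pow_solution {F : ℝ≥0 → X →L[𝕜] X} (hF : MemF F) {l : ℝ}
    {f y : ℝ → X}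
    (hd : ∀ t ∈ Ico 0 l, Tendsto (fun r : ℝ => ((r - t : ℝ) : 𝕜)⁻¹ • (f r - f t))
      (𝓝[Ico 0 l \ {t}] t) (𝓝 (y t)))
    (hy : ∀ t ∈ Ico 0 l, (f t, y t) ∈ closure (mefGraph F : Set (X × X)))
    {t₀ : ℝ} (ht₀ : t₀ < l) :
    TendstoUniformlyOn (fun (n : ℕ) (t : ℝ) => (F (t.toNNReal / n) ^ n) (f 0)) f atTop
      (Icc 0 t₀) := by
  -- Joint convergence in `(n, t)` at each point of the compact interval, to a continuous limit.
  rw [← tendstoLocallyUniformlyOn_iff_tendstoUniformlyOn_of_compact isCompact_Icc,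
    tendstoLocallyUniformlyOn_iff_filter]
  intro t ht
  have htl : t ∈ Ico 0 l := ⟨ht.1, ht.2.trans_lt ht₀⟩
  have h1 : Tendsto (fun q : ℕ × ℝ => f q.2) (atTop ×ˢ 𝓝[Icc 0 t₀] t) (𝓝 (f t)) :=
    ((continuousWithinAt_of_tendsto_slope (hd t htl)).mono_left
      (nhdsWithin_mono _ fun r hr => ⟨hr.1, hr.2.trans_lt ht₀⟩)).comp tendsto_snd
  have h2 : Tendsto (fun q : ℕ × ℝ => (F (q.2.toNNReal / q.1) ^ q.1) (f 0))
      (atTop ×ˢ 𝓝[Icc 0 t₀] t) (𝓝 (f t)) :=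
    (hF.tendsto_pow_solution hd hy htl).comp ((tendsto_stepFilter t).mono_left
      (prod_mono_right _ (nhdsWithin_mono _ Icc_subset_Ici_self)))
  exact tendstoUniformlyOnFilter_iff_tendsto.2
    ((h1.prodMk_nhds h2).mono_right (nhds_le_uniformity (f t)))

end Polynormable

end Chernoff

/-! ### Single-valuedness, closability and uniform convergence -/

open Chernoff

theorem theorem5p1 {𝕜 X : Type*} [RCLike 𝕜] [AddCommGroup X] [Module 𝕜 X]
    [UniformSpace X] [IsUniformAddGroup X] [ContinuousSMul 𝕜 X] [PolynormableSpace 𝕜 X] [T2Space X]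
    (F : ℝ≥0 → X →L[𝕜] X) (hF : Chernoff.MemF F)
    (Z : X →ₗ.[𝕜] X) (hdom : Z.domain ≤ (Chernoff.effDeriv F).domain)
    (hval : ∀ (g : X) (hg : g ∈ Z.domain), Z ⟨g, hg⟩ = Chernoff.effDeriv F ⟨g, hdom hg⟩) :
    Chernoff.MefSingleValued F ∧ Z.IsClosable ∧
      ∀ (l : ℝ) (h : X) (f : ℝ → X), Chernoff.IsLocalSolution Z.closure l h f →
        ∀ t₀ ∈ Ioo 0 l,
          TendstoUniformlyOn (fun (n : ℕ) (t : ℝ) => (F (t.toNNReal / n) ^ n) h) f atTop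
            (Icc 0 t₀) := by
  have hzero : ∀ y : X, ((0 : X), y) ∈ (mefGraph F).topologicalClosure → y = 0 := fun y hy =>
    hF.eq_zero_of_mem_closure_mefGraph hy
  have hsub : ∀ x ∈ mefGraph F, x.1 = 0 → x.2 = 0 := by
    rintro ⟨x, y⟩ hxy rfl
    exact hzero y ((mefGraph F).le_topologicalClosure hxy)
  have hle : Z.graph ≤ mefGraph F := by
    rintro ⟨x, y⟩ hxy
    obtain ⟨hx, rfl⟩ : ∃ hx : x ∈ Z.domain, Z ⟨x, hx⟩ = y := by
      obtain ⟨⟨x', hx'⟩, rfl, rfl⟩ := (Z.mem_graph_iff).1 hxy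
      exact ⟨hx', rfl⟩
    rw [hval x hx]
    exact Submodule.mem_graph_toLinearPMap (fun a ha => hsub a ha) ⟨x, hdom hx⟩
  have hclos : Z.IsClosable := by
    refine ⟨Z.graph.topologicalClosure.toLinearPMap,
      (Submodule.toLinearPMap_graph_eq _ ?_).symm⟩
    rintro ⟨x, y⟩ hxy rfl
    exact hzero y (Submodule.topologicalClosure_mono hle hxy)
  refine ⟨?_, hclos, ?_⟩
  · rintro x ⟨g, hg⟩
    refine ⟨g, hg, fun g' hg' => ?_⟩
    have := hsub _ ((mefGraph F).sub_mem (x := (x, g')) (y := (x, g)) hg' hg) (by simp)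
    exact sub_eq_zero.1 this
  · rintro l h f hf t₀ ht₀
    choose hfd hft using hf.deriv
    rw [← hf.init]
    classical
    refine hF.tendstoUniformlyOn_pow_solution
      (y := fun t => if ht : t ∈ Ico 0 l then Z.closure ⟨f t, hfd t ht⟩ else 0) ?_ ?_ ht₀.2
    · intro t ht
      simpa [ht] using hft t ht
    · intro t ht
      have hmem : (f t, Z.closure ⟨f t, hfd t ht⟩) ∈ Z.closure.graph :=
        Z.closure.mem_graph ⟨f t, hfd t ht⟩
      rw [← hclos.graph_closure_eq_closure_graph] at hmem
      have := Submodule.topologicalClosure_mono hle hmem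
      rw [dif_pos ht]
      exact this
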